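/- **Theorem 2.1 (Yoccoz's lower bound).** For $\omega\in\mathbb R\setminus\mathbb Q$ put $\lambda=e^{2\pi i\omega}$ and let $S_\lambda$ be the set of germs $F$ that are analytic and injective on the unit disk $\mathbb D=\{z\in\mathbb C: |z|<1\}$ with $F(0)=0$ and $F'(0)=\lambda$. For $F\in S_\lambda$ let $H_F(z)=z+\sum_{n\ge 2}h_nz^n\in\mathbb C[[z]]$ be the unique tangent-to-identity formal power series such that $F(H_F(z))=H_F(\lambda z)$, let $R(F)\in[0,+\infty]$ be its radius of convergence, and set $$R(\omega)=\inf_{F\in S_\lambda}R(F).$$ Let $(q_n)_{n\ge 0}$ be the denominators of the convergents of the continued fraction of $\omega$ (so $q_0=1$), and let $$B(\omega)=\sum_{n\ge 0}\frac{\log q_{n+1}}{q_n}\in[0,+\infty]$$ be the Brjuno function. Then there is a universal constant $C$, independent of $\omega$, such that for every $\omega\in\mathbb R\setminus\mathbb Q$ $$\log R(\omega)\ \ge\ -B(\omega)-C ,$$ where $\log 0=-\infty$, and the right-hand side is $-\infty$ if $B(\omega)=+\infty$. -/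

import Mathlib

open scoped ENNReal

noncomputable section

namespace SiegelCenter

/-! ### Continued fractions and the Brjuno function -/

/-- The denominator `q_n` of the `n`-th convergent of the (Gauss) continued fraction of `ω`;
`q_0 = 1`, `q_1 = a_1` and `q_{n+2} = a_{n+2} q_{n+1} + q_n`. -/
def convDen (ω : ℝ) (n : ℕ) : ℝ := (GenContFract.of ω).dens n

lemma convDen_zero (ω : ℝ) : convDen ω 0 = 1 := GenContFract.zeroth_den_eq_one

lemma one_le_convDen (ω : ℝ) (n : ℕ) : 1 ≤ convDen ω n := by
  induction n with
  | zero => exact (convDen_zero ω).ge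
  | succ n ih => exact ih.trans GenContFract.of_den_mono

/-- The terms of the Brjuno series are nonnegative, so `ENNReal.ofReal` does not change them. -/
lemma brjuno_term_nonneg (ω : ℝ) (n : ℕ) :
    0 ≤ Real.log (convDen ω (n + 1)) / convDen ω n :=
  div_nonneg (Real.log_nonneg (one_le_convDen ω (n + 1)))
    (zero_le_one.trans (one_le_convDen ω n))

/-- The Brjuno function `B(ω) = ∑_{n ≥ 0} log q_{n+1} / q_n`, with values in `[0, +∞]`. -/
def brjunoFunction (ω : ℝ) : ℝ≥0∞ :=
  ∑' n : ℕ, ENNReal.ofReal (Real.log (convDen ω (n + 1)) / convDen ω n)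

/-! ### Univalent germs -/

/-- `S_λ`: functions that are analytic and injective on the open unit disk, fix `0`, and have
derivative `λ` at `0`. -/
def univalentGerms (lam : ℂ) : Set (ℂ → ℂ) :=
  {f | AnalyticOnNhd ℂ f (Metric.ball 0 1) ∧ Set.InjOn f (Metric.ball 0 1) ∧
    f 0 = 0 ∧ deriv f 0 = lam}

/-- The Taylor series of `f` at `0`, as a formal power series. -/
def taylorSeries (f : ℂ → ℂ) : PowerSeries ℂ :=
  PowerSeries.mk fun n => iteratedDeriv n f 0 / (n.factorial : ℂ)

/-- The radius of convergence, in `[0, +∞]`, of a formal power series. -/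
def convRadius (H : PowerSeries ℂ) : ℝ≥0∞ :=
  (FormalMultilinearSeries.ofScalars ℂ fun n => PowerSeries.coeff n H).radius

/-! ### The formal linearization -/

/-- `H ∈ z + z² ℂ[[z]]` satisfies `F ∘ H = H ∘ R_λ`, where `λ` is the linear coefficient of `F`
and `R_λ(z) = λ z`. -/
structure IsLinearization (F H : PowerSeries ℂ) : Prop where
  coeff_zero : PowerSeries.coeff 0 H = 0
  coeff_one : PowerSeries.coeff 1 H = 1
  conj : F.subst H = PowerSeries.rescale (PowerSeries.coeff 1 F) H

/-- The part of the `n`-th coefficient of `F ∘ H` that comes from the terms of `F` of degree at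
least two. -/
def higherPart (F H : PowerSeries ℂ) (n : ℕ) : ℂ :=
  ∑ m ∈ Finset.Icc 2 n, PowerSeries.coeff m F * PowerSeries.coeff n (H ^ m)

lemma coeff_subst_eq (F H : PowerSeries ℂ) (hF : PowerSeries.coeff 0 F = 0)
    (hH : PowerSeries.coeff 0 H = 0) (n : ℕ) (hn : 1 ≤ n) :
    PowerSeries.coeff n (F.subst H) =
      PowerSeries.coeff 1 F * PowerSeries.coeff n H + higherPart F H n := by
  have hH' : PowerSeries.constantCoeff H = 0 := by simpa using hH
  have hX : (PowerSeries.X : PowerSeries ℂ) ∣ H := PowerSeries.X_dvd_iff.2 hH'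
  rw [PowerSeries.coeff_subst' (PowerSeries.HasSubst.of_constantCoeff_zero' hH')]
  rw [finsum_eq_sum_of_support_subset (s := Finset.range (n + 1))]
  · rw [Finset.range_eq_Ico, Finset.sum_eq_sum_Ico_succ_bot (by omega),
      Finset.sum_eq_sum_Ico_succ_bot (by omega), hF]
    simp only [smul_eq_mul, zero_mul, zero_add, pow_one, higherPart]
    rfl
  · intro m hm
    simp only [Function.mem_support, ne_eq] at hm
    simp only [Finset.coe_range, Set.mem_Iio]
    by_contra hlt
    exact hm (by
      rw [PowerSeries.X_pow_dvd_iff.1 (pow_dvd_pow_of_dvd hX m) n (by omega), smul_zero])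

/-- For `m ≥ 2` the `n`-th coefficient of `H ^ m` depends only on the coefficients of `H` of
degree less than `n`. -/
lemma higherPart_congr (F H H' : PowerSeries ℂ) (hH : PowerSeries.coeff 0 H = 0)
    (hH' : PowerSeries.coeff 0 H' = 0) (n : ℕ)
    (h : ∀ k < n, PowerSeries.coeff k H = PowerSeries.coeff k H') :
    higherPart F H n = higherPart F H' n := by
  refine Finset.sum_congr rfl fun m hm => ?_
  obtain ⟨hm2, -⟩ := Finset.mem_Icc.1 hm
  congr 1
  have hX : (PowerSeries.X : PowerSeries ℂ) ∣ H := PowerSeries.X_dvd_iff.2 (by simpa using hH)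
  have hX' : (PowerSeries.X : PowerSeries ℂ) ∣ H' := PowerSeries.X_dvd_iff.2 (by simpa using hH')
  have hd : (PowerSeries.X : PowerSeries ℂ) ^ n ∣ H - H' :=
    PowerSeries.X_pow_dvd_iff.2 fun k hk => by rw [map_sub, h k hk, sub_self]
  have hs : (PowerSeries.X : PowerSeries ℂ) ∣
      ∑ i ∈ Finset.range m, H ^ i * H' ^ (m - 1 - i) := by
    refine Finset.dvd_sum fun i _ => ?_
    rcases Nat.eq_zero_or_pos i with rfl | hi
    · exact Dvd.dvd.mul_left (dvd_pow hX' (by omega)) _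
    · exact Dvd.dvd.mul_right (dvd_pow hX (by omega)) _
  have key : (PowerSeries.X : PowerSeries ℂ) ^ (n + 1) ∣ H ^ m - H' ^ m := by
    rw [← (Commute.all H H').geom_sum₂_mul, pow_succ']
    exact mul_dvd_mul hs hd
  have := PowerSeries.X_pow_dvd_iff.1 key n (Nat.lt_succ_self n)
  rwa [map_sub, sub_eq_zero] at this

lemma isLinearization_iff (F H : PowerSeries ℂ) (hF : PowerSeries.coeff 0 F = 0)
    (hlam : ∀ n : ℕ, 2 ≤ n → PowerSeries.coeff 1 F ^ n ≠ PowerSeries.coeff 1 F) :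
    IsLinearization F H ↔ PowerSeries.coeff 0 H = 0 ∧ PowerSeries.coeff 1 H = 1 ∧
      ∀ n : ℕ, 2 ≤ n → PowerSeries.coeff n H =
        (PowerSeries.coeff 1 F ^ n - PowerSeries.coeff 1 F)⁻¹ * higherPart F H n := by
  constructor
  · rintro ⟨h0, h1, hc⟩
    refine ⟨h0, h1, fun n hn => ?_⟩
    have h := congrArg (PowerSeries.coeff n) hc
    rw [coeff_subst_eq F H hF h0 n (by omega), PowerSeries.coeff_rescale] at h
    rw [eq_inv_mul_iff_mul_eq₀ (sub_ne_zero.2 (hlam n hn))]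
    linear_combination -h
  · rintro ⟨h0, h1, hr⟩
    refine ⟨h0, h1, ?_⟩
    ext n
    rw [PowerSeries.coeff_rescale]
    rcases Nat.lt_or_ge n 1 with hn | hn
    · obtain rfl : n = 0 := by omega
      have h0' : PowerSeries.constantCoeff H = 0 := by simpa using h0
      have := PowerSeries.constantCoeff_subst_eq_zero (a := H) h0' F
        (by simpa using hF)
      rw [h0, mul_zero, PowerSeries.coeff_zero_eq_constantCoeff]
      exact this
    · rw [coeff_subst_eq F H hF h0 n hn]
      rcases Nat.lt_or_ge n 2 with hn2 | hn2
      · obtain rfl : n = 1 := by omega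
        simp [higherPart]
      · have h := hr n hn2
        rw [eq_inv_mul_iff_mul_eq₀ (sub_ne_zero.2 (hlam n hn2))] at h
        linear_combination -h

/-- The coefficients of the linearization, by recursion on the degree. -/
def linCoeff (F : PowerSeries ℂ) (n : ℕ) : ℂ :=
  if n = 0 then 0 else if n = 1 then 1 else
    (PowerSeries.coeff 1 F ^ n - PowerSeries.coeff 1 F)⁻¹ *
      higherPart F (PowerSeries.mk fun k => if _h : k < n then linCoeff F k else 0) n
termination_by n

/-- Existence and uniqueness of the formal linearization when the linear coefficient `λ` of `F`
satisfies `λ ^ n ≠ λ` for all `n ≥ 2`. -/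
theorem existsUnique_isLinearization (F : PowerSeries ℂ) (hF : PowerSeries.coeff 0 F = 0)
    (hlam : ∀ n : ℕ, 2 ≤ n → PowerSeries.coeff 1 F ^ n ≠ PowerSeries.coeff 1 F) :
    ∃! H : PowerSeries ℂ, IsLinearization F H := by
  refine ⟨PowerSeries.mk (linCoeff F), ?_, fun H hH => ?_⟩
  · have h0 : linCoeff F 0 = 0 := by rw [linCoeff]; simp
    have h1 : linCoeff F 1 = 1 := by rw [linCoeff]; simp
    refine (isLinearization_iff F _ hF hlam).2 ⟨by simpa using h0, by simpa using h1, ?_⟩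
    intro n hn
    rw [PowerSeries.coeff_mk, linCoeff, if_neg (by omega), if_neg (by omega)]
    congr 1
    refine higherPart_congr F _ _ ?_ (by simpa using h0) n fun k hk => ?_
    · rw [PowerSeries.coeff_mk, dif_pos (by omega), h0]
    · rw [PowerSeries.coeff_mk, dif_pos hk, PowerSeries.coeff_mk]
  · obtain ⟨h0, h1, hr⟩ := (isLinearization_iff F H hF hlam).1 hH
    ext n
    rw [PowerSeries.coeff_mk]
    induction n using Nat.strong_induction_on with
    | _ n ih =>
      rw [linCoeff]
      split_ifs with hn0 hn1
      · rw [hn0, h0]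
      · rw [hn1, h1]
      · rw [hr n (by omega)]
        congr 1
        refine higherPart_congr F _ _ h0 ?_ n fun k hk => ?_
        · rw [PowerSeries.coeff_mk, dif_pos (by omega), linCoeff, if_pos rfl]
        · rw [PowerSeries.coeff_mk, dif_pos hk, ih k hk]

open Classical in
/-- The unique tangent-to-identity formal linearization `H_F` of `F` (and the junk value `0` if
it does not exist or is not unique). -/
def linearization (F : PowerSeries ℂ) : PowerSeries ℂ :=
  if h : ∃! H : PowerSeries ℂ, IsLinearization F H then h.choose else 0

/-- The multiplier `e^{2πiω}`. -/
def multiplier (ω : ℝ) : ℂ := Complex.exp (2 * Real.pi * Complex.I * ω)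

lemma multiplier_pow_ne {ω : ℝ} (hω : Irrational ω) (n : ℕ) (hn : 2 ≤ n) :
    multiplier ω ^ n ≠ multiplier ω := by
  intro h
  rw [multiplier, ← Complex.exp_nat_mul, Complex.exp_eq_exp_iff_exists_int] at h
  obtain ⟨k, hk⟩ := h
  have hpi : (2 * Real.pi * Complex.I : ℂ) ≠ 0 := Complex.two_pi_I_ne_zero
  have h2 : ((n : ℂ) - 1) * ω = k := mul_left_cancel₀ hpi (by linear_combination hk)
  have h3 : (((n - 1 : ℤ) : ℝ)) * ω = k := by
    have : (((n : ℝ) - 1) * ω : ℝ) = (k : ℝ) := by exact_mod_cast h2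
    push_cast
    exact this
  exact (hω.intCast_mul (by omega : (n - 1 : ℤ) ≠ 0)).ne_int k h3

/-- For irrational `ω` every germ in `S_λ` has exactly one formal linearization, and
`linearization` returns it. -/
theorem isLinearization_linearization {ω : ℝ} (hω : Irrational ω) {f : ℂ → ℂ}
    (hf : f ∈ univalentGerms (multiplier ω)) :
    IsLinearization (taylorSeries f) (linearization (taylorSeries f)) ∧
      ∀ H : PowerSeries ℂ, IsLinearization (taylorSeries f) H →
        H = linearization (taylorSeries f) := by
  obtain ⟨-, -, h0, h1⟩ := hf
  have c1 : PowerSeries.coeff 1 (taylorSeries f) = multiplier ω := by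
    simp [taylorSeries, h1]
  have hex : ∃! H : PowerSeries ℂ, IsLinearization (taylorSeries f) H := by
    refine existsUnique_isLinearization _ (by simp [taylorSeries, h0]) ?_
    rw [c1]
    exact multiplier_pow_ne hω
  rw [linearization, dif_pos hex]
  exact ⟨hex.choose_spec.1, hex.choose_spec.2⟩

/-- `R(ω) = inf_{F ∈ S_λ} R(F)`, `λ = e^{2πiω}`, where `R(F)` is the radius of convergence of
`H_F`; a value in `[0, +∞]`. -/
def infRadius (ω : ℝ) : ℝ≥0∞ :=
  ⨅ f ∈ univalentGerms (multiplier ω), convRadius (linearization (taylorSeries f))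

end SiegelCenter

end

/-!
The proof is the classical majorant method, with the small divisors counted sharply enough that
the Brjuno function appears with coefficient one.

The coefficients `h_n` of the linearization solve `(λ ^ n - λ) h_n = ∑ f_m (H ^ m)_n`, the sum
running over `2 ≤ m ≤ n`. Two universal facts control the right-hand side.

* Taylor coefficients: `|f_m| ≤ c ^ (m - 1)` for every univalent germ
  (`norm_coeff_taylorSeries_le`). Only a universal bound on a fixed disk is needed, because
  rescaling costs a constant in the logarithm of the radius. Such a germ `f` omits a value `w` with
  `|w| ≤ 2`; the image of `log (1 - f / w)` is disjoint from its translate by `2πi`, so Bloch's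
  theorem bounds its derivative (`norm_le_of_univalent`).
* Small divisors: let `D` be the least superadditive function with
  `D (n + 1) ≥ D n + log⁺ (1 / |λ ^ (n + 1) - 1|)`. Then
  `|h_n| ≤ (16 c) ^ (n - 1) e ^ D (n - 1) / n²` by induction (`norm_coeff_linearization_le`), and it
  remains to see that `D n ≤ n (B(ω) + C)`.

`D n` is the maximal cost of a tree of size `n`. Splitting the divisors by size at the scales
`1 / q_k`, it suffices to bound the number of nodes of a tree at which `‖n ω‖ ≤ 1 / (8 q_k)` by
`n (1 / q_k + 4 / q_{k+1})` (`DivisorTree.weight_indicator_le`). Differences below `q_{k+1} / 2` of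
indices with this property are multiples of `q_k` (`convergent_dvd`). So below the scale
`E = q_{k+1} / 2` the count is at most `⌊n / q_k⌋`, and beyond it a loss of `2 / E` per unit of size
pays for the change of residue class. Weighting by `log q_{k+1}`, the first terms add up to
`B(ω)`, and the others, `4 log q_{k+1} / q_{k+1}`, to a universal constant because the denominators
grow at least like the Fibonacci numbers (`weight_divisorCost_le`).
-/

noncomputable section

namespace SiegelCenter

/-! ### Counting small divisors in trees -/

/-- The shapes in which small divisors accumulate along the recursion for the linearization. A
product of coefficients joins their trees, and the division that produces the coefficient of degree
`n + 1` adds an `up` node completing a tree of size `n`; the shift by one turns products into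
sums of sizes. -/
inductive DivisorTree : Type
  | nil : DivisorTree
  | join : DivisorTree → DivisorTree → DivisorTree
  | up : DivisorTree → DivisorTree

namespace DivisorTree

/-- The size of a tree: the number of its `up` nodes. -/
def size : DivisorTree → ℕ
  | nil => 0
  | join a b => a.size + b.size
  | up a => a.size + 1

/-- The total cost of a tree, when an `up` node that produces a tree of size `n` costs `l n`. -/
def weight (l : ℕ → ℝ) : DivisorTree → ℝ
  | nil => 0
  | join a b => a.weight l + b.weight l
  | up a => a.weight l + l (a.size + 1)

lemma exists_size_eq (n : ℕ) : ∃ t : DivisorTree, t.size = n := by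
  induction n with
  | zero => exact ⟨nil, rfl⟩
  | succ n ih =>
    obtain ⟨t, ht⟩ := ih
    exact ⟨up t, by simp [size, ht]⟩

/-- The bound for the number of nodes whose size lies in a sparse set: `⌊n / q⌋` as long as
divisibility by `q` is in force, and `(1 / q + 2 / E) n - 1` beyond the scale `E`. -/
def countBound (q : ℕ) (E : ℝ) (n : ℕ) : ℝ :=
  if (n : ℝ) < E then ((n / q : ℕ) : ℝ) else n / q + 2 * n / E - 1

section count

variable {q : ℕ} {E : ℝ}

lemma countBound_of_lt {n : ℕ} (h : (n : ℝ) < E) : countBound q E n = ((n / q : ℕ) : ℝ) :=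
  if_pos h

lemma countBound_of_le {n : ℕ} (h : E ≤ n) : countBound q E n = n / q + 2 * n / E - 1 :=
  if_neg h.not_gt

lemma two_le_two_mul_div (hE : 0 < E) {x : ℝ} (h : E ≤ x) : 2 ≤ 2 * x / E := by
  rw [le_div_iff₀ hE]; linarith

lemma countBound_add_le (hE : 0 < E) (a b : ℕ) :
    countBound q E a + countBound q E b ≤ countBound q E (a + b) := by
  have fa : ((a / q : ℕ) : ℝ) ≤ a / q := Nat.cast_div_le
  have fb : ((b / q : ℕ) : ℝ) ≤ b / q := Nat.cast_div_le
  have ea : 0 ≤ 2 * (a : ℝ) / E := by positivity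
  have eb : 0 ≤ 2 * (b : ℝ) / E := by positivity
  by_cases hab : ((a + b : ℕ) : ℝ) < E
  · have hab' : (a : ℝ) + b < E := by exact_mod_cast hab
    rw [countBound_of_lt hab, countBound_of_lt (by linarith [Nat.cast_nonneg (α := ℝ) b]),
      countBound_of_lt (by linarith [Nat.cast_nonneg (α := ℝ) a])]
    exact_mod_cast Nat.div_add_div_le_add_div (x := a) (y := b) (z := q)
  · have h2 := two_le_two_mul_div hE (not_lt.1 hab)
    rw [countBound_of_le (not_lt.1 hab)]
    push_cast at h2 ⊢
    rw [mul_add, add_div] at h2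
    rw [add_div, mul_add, add_div]
    rcases lt_or_ge (a : ℝ) E with ha | ha <;> rcases lt_or_ge (b : ℝ) E with hb | hb
    · rw [countBound_of_lt ha, countBound_of_lt hb]; linarith
    · rw [countBound_of_lt ha, countBound_of_le hb]; linarith
    · rw [countBound_of_le ha, countBound_of_lt hb]; linarith
    · rw [countBound_of_le ha, countBound_of_le hb]; linarith

lemma countBound_nonneg (hE : 0 < E) (n : ℕ) : 0 ≤ countBound q E n := by
  rcases lt_or_ge (n : ℝ) E with h | h
  · rw [countBound_of_lt h]; positivity
  · rw [countBound_of_le h]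
    have := two_le_two_mul_div hE h
    have : (0 : ℝ) ≤ n / q := by positivity
    linarith

lemma countBound_le_succ (hE : 0 < E) (n : ℕ) :
    countBound q E n ≤ countBound q E (n + 1) := by
  linarith [countBound_add_le (q := q) hE n 1, countBound_nonneg (q := q) hE 1]

lemma one_add_pred_div (hq : 0 < q) {m : ℕ} (hm : 0 < m) (h : q ∣ m) :
    1 + (m - 1) / q ≤ m / q := by
  obtain ⟨c, rfl⟩ := h
  rw [Nat.mul_div_cancel_left c hq]
  have : (q * c - 1) / q < c := by
    rw [Nat.div_lt_iff_lt_mul hq, mul_comm c q]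
    exact Nat.sub_lt hm one_pos
  omega

/-- A node of size `s` on top of a tree of size `x` below the scale `E`. -/
lemma one_add_div_add_div_le (hq : 0 < q) (hE : 0 < E) {x s : ℕ} (hxs : x < s)
    (hs : (s : ℝ) < E → q ∣ s) :
    1 + ((x / q : ℕ) : ℝ) + (((s - 1 - x) / q : ℕ) : ℝ) ≤ countBound q E s := by
  have h1 : x / q + (s - 1 - x) / q ≤ (s - 1) / q := by
    have := Nat.div_add_div_le_add_div (x := x) (y := (s - 1 - x)) (z := q)
    rwa [show x + (s - 1 - x) = s - 1 by omega] at this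
  rcases lt_or_ge (s : ℝ) E with h | h
  · rw [countBound_of_lt h]
    have := one_add_pred_div hq (by omega) (hs h)
    exact_mod_cast (by omega : 1 + x / q + (s - 1 - x) / q ≤ s / q)
  · rw [countBound_of_le h]
    have h2 := two_le_two_mul_div hE h
    have h3 : ((s / q : ℕ) : ℝ) ≤ s / q := Nat.cast_div_le
    have h4 : x / q + (s - 1 - x) / q ≤ s / q :=
      h1.trans (Nat.div_le_div_right (Nat.sub_le _ _))
    have h5 : ((x / q : ℕ) : ℝ) + (((s - 1 - x) / q : ℕ) : ℝ) ≤ ((s / q : ℕ) : ℝ) := by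
      exact_mod_cast h4
    linarith

/-- A node of size `s` on top of a node of size `x` beyond the scale `E`, both in the sparse
set. -/
lemma one_add_countBound_add_div_le (hq : 0 < q) (hE : 0 < E) {x s : ℕ} (hxs : x < s)
    (hx : E ≤ x) (hs : ((s - x : ℕ) : ℝ) < E → q ∣ s - x) :
    1 + countBound q E x + (((s - 1 - x) / q : ℕ) : ℝ) ≤ countBound q E s := by
  have hxs' : (x : ℝ) ≤ s := by exact_mod_cast hxs.le
  have hsub : ((s - x : ℕ) : ℝ) = s - x := Nat.cast_sub hxs.le
  have e1 : ((s - x : ℕ) : ℝ) / q = s / q - x / q := by rw [hsub, sub_div]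
  have e2 : 2 * ((s - x : ℕ) : ℝ) / E = 2 * s / E - 2 * x / E := by rw [hsub]; ring
  have e3 : (((s - x) / q : ℕ) : ℝ) ≤ ((s - x : ℕ) : ℝ) / q := Nat.cast_div_le
  have e4 : 0 ≤ 2 * ((s - x : ℕ) : ℝ) / E := by positivity
  have e5 : s - 1 - x = s - x - 1 := by omega
  rw [countBound_of_le hx, countBound_of_le (hx.trans hxs'), e5]
  rcases lt_or_ge ((s - x : ℕ) : ℝ) E with h | h
  · have h1 : (1 : ℝ) + (((s - x - 1) / q : ℕ) : ℝ) ≤ (((s - x) / q : ℕ) : ℝ) := by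
      exact_mod_cast one_add_pred_div hq (by omega) (hs h)
    linarith
  · have h1 : (((s - x - 1) / q : ℕ) : ℝ) ≤ (((s - x) / q : ℕ) : ℝ) := by
      exact_mod_cast Nat.div_le_div_right (Nat.sub_le _ _)
    have h2 := two_le_two_mul_div hE h
    linarith

/-- The counting lemma for a set `A` in which, as in `A ∪ {0}`, differences below `E` are
divisible by `q`. The second conclusion, about a further node of size `s ∈ A` placed above `t`,
carries the induction: it allows the part of `t` below the scale `E` to be merged into the
divisibility count of `s`. -/
lemma weight_indicator_aux (hq : 0 < q) (hE : 0 < E) {A : Set ℕ}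
    (h0 : ∀ a ∈ A, (a : ℝ) < E → q ∣ a)
    (hA : ∀ a ∈ A, ∀ b ∈ A, a < b → ((b - a : ℕ) : ℝ) < E → q ∣ b - a) (t : DivisorTree) :
    t.weight (A.indicator 1) ≤ countBound q E t.size ∧
      ∀ s ∈ A, t.size < s →
        1 + t.weight (A.indicator 1) + (((s - 1 - t.size) / q : ℕ) : ℝ) ≤ countBound q E s := by
  induction t with
  | nil =>
    refine ⟨countBound_nonneg hE _, fun s hs h => ?_⟩
    simpa [weight, size] using one_add_div_add_div_le hq hE (x := 0) h (h0 s hs)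
  | join a b iha ihb =>
    obtain ⟨ha, ha'⟩ := iha
    obtain ⟨hb, hb'⟩ := ihb
    simp only [weight, size]
    refine ⟨(add_le_add ha hb).trans (countBound_add_le hE _ _), fun s hs h => ?_⟩
    -- A branch below the scale `E` merges into the divisibility count of `s`.
    rcases lt_or_ge (b.size : ℝ) E with hbE | hbE
    · rw [countBound_of_lt hbE] at hb
      have h1 := ha' s hs (by omega)
      have h2 : b.size / q + (s - 1 - (a.size + b.size)) / q ≤ (s - 1 - a.size) / q := by
        have := Nat.div_add_div_le_add_div (x := b.size) (y := (s - 1 - (a.size + b.size))) (z := q)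
        rwa [show b.size + (s - 1 - (a.size + b.size)) = s - 1 - a.size by omega] at this
      have h3 : ((b.size / q : ℕ) : ℝ) + (((s - 1 - (a.size + b.size)) / q : ℕ) : ℝ) ≤
        (((s - 1 - a.size) / q : ℕ) : ℝ) := by exact_mod_cast h2
      linarith
    rcases lt_or_ge (a.size : ℝ) E with haE | haE
    · rw [countBound_of_lt haE] at ha
      have h1 := hb' s hs (by omega)
      have h2 : a.size / q + (s - 1 - (a.size + b.size)) / q ≤ (s - 1 - b.size) / q := by
        have := Nat.div_add_div_le_add_div (x := a.size) (y := (s - 1 - (a.size + b.size))) (z := q)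
        rwa [show a.size + (s - 1 - (a.size + b.size)) = s - 1 - b.size by omega] at this
      have h3 : ((a.size / q : ℕ) : ℝ) + (((s - 1 - (a.size + b.size)) / q : ℕ) : ℝ) ≤
        (((s - 1 - b.size) / q : ℕ) : ℝ) := by exact_mod_cast h2
      linarith
    -- For two branches beyond `E`, the two summands `-1` pay for the node `s`.
    · rw [countBound_of_le haE] at ha
      rw [countBound_of_le hbE] at hb
      have hs' : (a.size : ℝ) + b.size ≤ s := by exact_mod_cast h.le
      rw [countBound_of_le (by linarith [Nat.cast_nonneg (α := ℝ) b.size])]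
      have h1 : (((s - 1 - (a.size + b.size)) / q : ℕ) : ℝ) ≤
          ((s - 1 - (a.size + b.size) : ℕ) : ℝ) / q := Nat.cast_div_le
      have h2 : ((s - 1 - (a.size + b.size) : ℕ) : ℝ) ≤ s - (a.size + b.size) := by
        have : ((s - 1 - (a.size + b.size) : ℕ) : ℝ) ≤ ((s - (a.size + b.size) : ℕ) : ℝ) := by
          exact_mod_cast (by omega : s - 1 - (a.size + b.size) ≤ s - (a.size + b.size))
        rwa [Nat.cast_sub h.le, Nat.cast_add] at this
      have h3 : ((s - 1 - (a.size + b.size) : ℕ) : ℝ) / q ≤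
          s / q - (a.size / q + b.size / q) := by
        rw [← add_div, ← sub_div]; gcongr
      have h4 : 2 * (a.size : ℝ) / E + 2 * b.size / E ≤ 2 * s / E := by
        rw [← add_div, ← mul_add]; gcongr
      linarith
  | up a iha =>
    obtain ⟨ha, ha'⟩ := iha
    simp only [weight, size]
    by_cases hA1 : a.size + 1 ∈ A
    · rw [Set.indicator_of_mem hA1, Pi.one_apply]
      have h1 : a.weight (A.indicator 1) + 1 ≤ countBound q E (a.size + 1) := by
        have := ha' _ hA1 (Nat.lt_succ_self _)
        simp only [add_tsub_cancel_right, tsub_self, Nat.zero_div, Nat.cast_zero] at this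
        linarith
      refine ⟨h1, fun s hs h => ?_⟩
      rcases lt_or_ge ((a.size + 1 : ℕ) : ℝ) E with hE1 | hE1
      · rw [countBound_of_lt hE1] at h1
        linarith [one_add_div_add_div_le hq hE h (h0 s hs)]
      · linarith [one_add_countBound_add_div_le hq hE h hE1 (hA _ hA1 s hs h)]
    · rw [Set.indicator_of_notMem hA1, add_zero]
      refine ⟨ha.trans (countBound_le_succ hE _), fun s hs h => ?_⟩
      have h1 := ha' s hs (by omega)
      have h2 : (((s - 1 - (a.size + 1)) / q : ℕ) : ℝ) ≤ (((s - 1 - a.size) / q : ℕ) : ℝ) := by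
        exact_mod_cast Nat.div_le_div_right (by omega)
      linarith

lemma weight_indicator_le (hq : 0 < q) (hE : 0 < E) {A : Set ℕ}
    (h0 : ∀ a ∈ A, (a : ℝ) < E → q ∣ a)
    (hA : ∀ a ∈ A, ∀ b ∈ A, a < b → ((b - a : ℕ) : ℝ) < E → q ∣ b - a) (t : DivisorTree) :
    t.weight (A.indicator 1) ≤ t.size * (1 / q + 2 / E) := by
  refine (weight_indicator_aux hq hE h0 hA t).1.trans ?_
  rw [mul_add, mul_one_div, mul_div_assoc', mul_comm (t.size : ℝ) 2]
  rcases lt_or_ge (t.size : ℝ) E with h | h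
  · rw [countBound_of_lt h]
    have h1 : ((t.size / q : ℕ) : ℝ) ≤ t.size / q := Nat.cast_div_le
    have h2 : 0 ≤ 2 * (t.size : ℝ) / E := by positivity
    linarith
  · rw [countBound_of_le h]; linarith

end count

lemma weight_le_sum {ι : Type*} (K : Finset ι) (w : ι → ℝ) (g : ι → ℕ → ℝ) (l : ℕ → ℝ) (L : ℝ)
    (t : DivisorTree)
    (h : ∀ j, 1 ≤ j → j ≤ t.size → l j ≤ L + ∑ k ∈ K, w k * g k j) :
    t.weight l ≤ L * t.size + ∑ k ∈ K, w k * t.weight (g k) := by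
  induction t with
  | nil => simp [weight, size]
  | join a b iha ihb =>
    have ha := iha fun j h1 h2 => h j h1 (h2.trans (Nat.le_add_right _ _))
    have hb := ihb fun j h1 h2 => h j h1 (h2.trans (Nat.le_add_left _ _))
    simp only [weight, size, mul_add, Finset.sum_add_distrib, Nat.cast_add]
    linarith
  | up a iha =>
    have ha := iha fun j h1 h2 => h j h1 (h2.trans (Nat.le_succ _))
    have hb := h (a.size + 1) (by omega) le_rfl
    simp only [weight, size, mul_add, Finset.sum_add_distrib, Nat.cast_add, Nat.cast_one]
    linarith

/-- If the costs of trees are linearly bounded, the maximal cost of a tree of size `n` is a linearly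
bounded superadditive function of `n` that grows by at least `l (n + 1)` from `n` to `n + 1`. -/
lemma exists_superadditive (l : ℕ → ℝ) (M : ℝ) (h : ∀ t : DivisorTree, t.weight l ≤ M * t.size) :
    ∃ D : ℕ → ℝ, 0 ≤ D 0 ∧ (∀ a b, D a + D b ≤ D (a + b)) ∧
      (∀ n, D n + l (n + 1) ≤ D (n + 1)) ∧ ∀ n, D n ≤ M * n := by
  let S : ℕ → Set ℝ := fun n => weight l '' {t | t.size = n}
  have hne : ∀ n, (S n).Nonempty := fun n =>
    let ⟨t, ht⟩ := exists_size_eq n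
    ⟨_, t, ht, rfl⟩
  have hub : ∀ n, ∀ x ∈ S n, x ≤ M * n := by
    rintro n _ ⟨t, rfl, rfl⟩
    exact h t
  have hbdd : ∀ n, BddAbove (S n) := fun n => ⟨_, hub n⟩
  refine ⟨fun n => sSup (S n), le_csSup (hbdd 0) ⟨nil, rfl, rfl⟩, fun a b => ?_, fun n => ?_,
    fun n => csSup_le (hne n) (hub n)⟩
  · rw [← le_sub_iff_add_le]
    refine csSup_le (hne a) ?_
    rintro _ ⟨s, rfl, rfl⟩
    rw [le_sub_comm]
    refine csSup_le (hne b) ?_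
    rintro _ ⟨t, rfl, rfl⟩
    rw [le_sub_iff_add_le']
    exact le_csSup (hbdd _) ⟨join s t, rfl, rfl⟩
  · rw [← le_sub_iff_add_le]
    refine csSup_le (hne n) ?_
    rintro _ ⟨s, rfl, rfl⟩
    rw [le_sub_iff_add_le]
    exact le_csSup (hbdd _) ⟨up s, rfl, rfl⟩

end DivisorTree

/-! ### Small divisors and the continued fraction -/

lemma not_terminatedAt {ω : ℝ} (hω : Irrational ω) (n : ℕ) :
    ¬ (GenContFract.of ω).TerminatedAt n := fun h =>
  let ⟨r, hr⟩ := (GenContFract.terminates_iff_rat ω).1 ⟨n, h⟩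
  hω ⟨r, hr.symm⟩

lemma exists_int_contsAux {ω : ℝ} (hω : Irrational ω) (n : ℕ) :
    ∃ p q : ℤ, (GenContFract.of ω).contsAux n = ⟨p, q⟩ := by
  induction n using Nat.twoStepInduction with
  | zero => exact ⟨1, 0, by simp [GenContFract.contsAux]⟩
  | one => exact ⟨⌊ω⌋, 1, by simp [GenContFract.contsAux]⟩
  | more n ih1 ih2 =>
    obtain ⟨p, q, h⟩ := ih1
    obtain ⟨p', q', h'⟩ := ih2
    obtain ⟨gp, hgp⟩ := Option.ne_none_iff_exists'.1 (not_terminatedAt hω n)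
    obtain ⟨ha, z, hz⟩ := GenContFract.of_partNum_eq_one_and_exists_int_partDen_eq hgp
    rw [GenContFract.contsAux_recurrence hgp h h', ha, hz]
    exact ⟨z * p' + p, z * q' + q, by simp⟩

lemma exists_int_nums_dens {ω : ℝ} (hω : Irrational ω) (n : ℕ) :
    ∃ p q : ℤ, (GenContFract.of ω).nums n = p ∧ (GenContFract.of ω).dens n = q := by
  obtain ⟨p, q, h⟩ := exists_int_contsAux hω (n + 1)
  refine ⟨p, q, ?_, ?_⟩
  · rw [GenContFract.num_eq_conts_a, GenContFract.nth_cont_eq_succ_nth_contAux, h]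
  · rw [GenContFract.den_eq_conts_b, GenContFract.nth_cont_eq_succ_nth_contAux, h]

lemma exists_convergent {ω : ℝ} (hω : Irrational ω) (n : ℕ) :
    ∃ (p : ℤ) (q : ℕ), 0 < q ∧ (q : ℝ) = convDen ω n ∧ IsCoprime p (q : ℤ) ∧
      |q * ω - p| ≤ 1 / convDen ω (n + 1) := by
  obtain ⟨p, q, hp, hq⟩ := exists_int_nums_dens hω n
  obtain ⟨p', q', hp', hq'⟩ := exists_int_nums_dens hω (n + 1)
  have hq1 : (1 : ℝ) ≤ q := hq ▸ one_le_convDen ω n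
  have hqpos : 0 < q := by exact_mod_cast zero_lt_one.trans_le hq1
  lift q to ℕ using hqpos.le
  have hconv : convDen ω n = q := hq
  refine ⟨p, q, by exact_mod_cast hqpos, hconv.symm, ?_, ?_⟩
  · have hdet := SimpContFract.determinant (s := SimpContFract.of ω) (n := n)
      (not_terminatedAt hω n)
    change (GenContFract.of ω).nums n * (GenContFract.of ω).dens (n + 1) -
      (GenContFract.of ω).dens n * (GenContFract.of ω).nums (n + 1) = _ at hdet
    rw [hp, hq, hp', hq'] at hdet
    have hdet' : p * q' - q * p' = (-1) ^ (n + 1) := by exact_mod_cast hdet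
    refine ⟨(-1) ^ (n + 1) * q', -((-1) ^ (n + 1) * p'), ?_⟩
    have : ((-1 : ℤ) ^ (n + 1)) * (-1) ^ (n + 1) = 1 := by
      rw [← mul_pow]; norm_num
    linear_combination (-1) ^ (n + 1) * hdet' + this
  · have h := GenContFract.abs_sub_convs_le (not_terminatedAt hω n)
    have hc : (GenContFract.of ω).convs n = p / q := by
      rw [GenContFract.conv_eq_num_div_den, hp, hq]; simp
    have hn1 := one_le_convDen ω (n + 1)
    have hq0 : (0 : ℝ) < q := by exact_mod_cast hqpos
    have e : (q : ℝ) * ω - p = q * (ω - p / q) := by field_simp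
    rw [e, abs_mul, abs_of_pos hq0, ← hc]
    refine (mul_le_mul_of_nonneg_left h hq0.le).trans (le_of_eq ?_)
    change (q : ℝ) * (1 / (convDen ω n * convDen ω (n + 1))) = _
    rw [hconv]
    field_simp

lemma fib_le_convDen {ω : ℝ} (hω : Irrational ω) (n : ℕ) :
    (Nat.fib (n + 1) : ℝ) ≤ convDen ω n :=
  GenContFract.succ_nth_fib_le_of_nth_den (Or.inr (not_terminatedAt hω _))

/-- The distance from `n ω` to the nearest integer. -/
def distInt (ω : ℝ) (n : ℕ) : ℝ := |n * ω - round (n * ω)|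

lemma distInt_pos {ω : ℝ} (hω : Irrational ω) {n : ℕ} (hn : 1 ≤ n) : 0 < distInt ω n :=
  abs_pos.2 (sub_ne_zero.2 ((hω.natCast_mul (by omega)).ne_int _))

lemma four_mul_distInt_le (ω : ℝ) (n : ℕ) : 4 * distInt ω n ≤ ‖multiplier ω ^ n - 1‖ := by
  set m := round (n * ω)
  set x : ℝ := n * ω - m
  have e : multiplier ω ^ n = Complex.exp (Complex.I * ((2 * Real.pi * x : ℝ) : ℂ)) := by
    rw [multiplier, ← Complex.exp_nat_mul, Complex.exp_eq_exp_iff_exists_int]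
    refine ⟨m, ?_⟩
    simp only [x]
    push_cast
    ring
  have hx : |x| ≤ 1 / 2 := abs_sub_round _
  rw [e, Complex.norm_exp_I_mul_ofReal_sub_one, Real.norm_eq_abs, abs_mul, abs_two]
  have h := Real.mul_abs_le_abs_sin (x := 2 * Real.pi * x / 2) (by
    rw [show 2 * Real.pi * x / 2 = Real.pi * x by ring, abs_mul, abs_of_pos Real.pi_pos]
    nlinarith [Real.pi_pos])
  rw [show 2 * Real.pi * x / 2 = Real.pi * x by ring, abs_mul, abs_of_pos Real.pi_pos] at h
  rw [show 2 * Real.pi * x / 2 = Real.pi * x by ring]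
  have h2 : 2 / Real.pi * (Real.pi * |x|) = 2 * |x| := by
    field_simp
  rw [h2] at h
  change 4 * |x| ≤ _
  linarith

/-- If `j ω` is close to an integer at the scale of the `k`-th convergent, and `j` is below half
the next denominator, then `j` is a multiple of the `k`-th denominator. -/
lemma convergent_dvd {ω : ℝ} (hω : Irrational ω) (k : ℕ) {q j : ℕ} (hq : (q : ℝ) = convDen ω k)
    (m : ℤ) (hm : |j * ω - m| ≤ 1 / (4 * q)) (hj : (j : ℝ) < convDen ω (k + 1) / 2) : q ∣ j := by
  obtain ⟨p, q', hq'pos, hq', hcop, happ⟩ := exists_convergent hω k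
  obtain rfl : q' = q := by exact_mod_cast hq'.trans hq.symm
  have hq0 : (0 : ℝ) < q' := by exact_mod_cast hq'pos
  set Q := convDen ω (k + 1)
  have hQ : 0 < Q := zero_lt_one.trans_le (one_le_convDen ω _)
  have h1 : |((j * p - m * q' : ℤ) : ℝ)| < 1 := by
    have e : ((j * p - m * q' : ℤ) : ℝ) = q' * (j * ω - m) - j * (q' * ω - p) := by
      push_cast; ring
    rw [e]
    refine (abs_sub _ _).trans_lt ?_
    rw [abs_mul, abs_mul, abs_of_pos hq0, Nat.abs_cast]
    have a1 : q' * |j * ω - m| ≤ 1 / 4 := by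
      refine (mul_le_mul_of_nonneg_left hm hq0.le).trans (le_of_eq ?_)
      field_simp
    have a2 : j * |q' * ω - p| ≤ 1 / 2 := by
      refine (mul_le_mul hj.le happ (abs_nonneg _) (by positivity)).trans (le_of_eq ?_)
      field_simp
    linarith
  have h2 : (j : ℤ) * p - m * q' = 0 := by
    rw [← Int.abs_lt_one_iff]
    exact_mod_cast h1
  have h3 : (q' : ℤ) ∣ j * p := ⟨m, by linarith⟩
  exact_mod_cast hcop.symm.dvd_of_dvd_mul_right h3

/-- The indices whose divisor is small at the scale of the `k`-th convergent. -/
def smallSet (ω : ℝ) (k : ℕ) : Set ℕ := {n | distInt ω n ≤ 1 / (8 * convDen ω k)}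

lemma smallSet_dvd {ω : ℝ} (hω : Irrational ω) (k : ℕ) {q : ℕ} (hq : (q : ℝ) = convDen ω k) :
    (∀ a ∈ smallSet ω k, (a : ℝ) < convDen ω (k + 1) / 2 → q ∣ a) ∧
      ∀ a ∈ smallSet ω k, ∀ b ∈ smallSet ω k, a < b →
        ((b - a : ℕ) : ℝ) < convDen ω (k + 1) / 2 → q ∣ b - a := by
  have hq1 : (1 : ℝ) ≤ q := hq ▸ one_le_convDen ω k
  have key : 1 / (8 * (q : ℝ)) + 1 / (8 * q) = 1 / (4 * q) := by field_simp; norm_num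
  have hpos : 0 ≤ 1 / (8 * (q : ℝ)) := by positivity
  refine ⟨fun a ha h => ?_, fun a ha b hb hab h => ?_⟩
  · rw [smallSet, Set.mem_ofPred_eq, ← hq] at ha
    exact convergent_dvd hω k hq (round (a * ω)) (by rw [distInt] at ha; linarith) h
  · rw [smallSet, Set.mem_ofPred_eq, ← hq, distInt] at ha hb
    refine convergent_dvd hω k hq (round (b * ω) - round (a * ω)) ?_ h
    rw [← key, Nat.cast_sub hab.le]
    have e : ((b : ℝ) - a) * ω - ((round (b * ω) - round (a * ω) : ℤ) : ℝ) =
        (b * ω - round (b * ω)) - (a * ω - round (a * ω)) := by push_cast; ring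
    rw [e]
    exact (abs_sub _ _).trans (add_le_add hb ha)

/-- The cost of the divisor `λ ^ n - 1`: the positive part of `-log |λ ^ n - 1|`. -/
def divisorCost (ω : ℝ) (n : ℕ) : ℝ := max 0 (-Real.log ‖multiplier ω ^ n - 1‖)

lemma divisorCost_le_of_lt {ω : ℝ} {n : ℕ} {q : ℝ} (hq : 1 ≤ q)
    (h : 1 / (8 * q) < distInt ω n) : divisorCost ω n ≤ Real.log 2 + Real.log q := by
  have hlog2 : 0 ≤ Real.log 2 := Real.log_nonneg (by norm_num)
  refine max_le (add_nonneg hlog2 (Real.log_nonneg hq)) ?_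
  rw [← Real.log_inv, ← Real.log_mul (by norm_num) (by positivity)]
  have h1 : 1 / (2 * q) ≤ ‖multiplier ω ^ n - 1‖ := by
    have : 4 * (1 / (8 * q)) = 1 / (2 * q) := by field_simp; norm_num
    linarith [four_mul_distInt_le ω n]
  have h0 : 0 < 1 / (2 * q) := by positivity
  refine Real.log_le_log (inv_pos.2 (h0.trans_le h1)) ?_
  rw [inv_le_comm₀ (h0.trans_le h1) (by positivity), ← one_div]
  exact h1

/-- A divisor that is not small at scale `M` is controlled by the scales below `M` at which it is
small. -/
lemma divisorCost_le_sum {ω : ℝ} {n : ℕ} (M : ℕ) (hM : n ∉ smallSet ω M) :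
    divisorCost ω n ≤ Real.log 2 + ∑ k ∈ Finset.range M,
      Real.log (convDen ω (k + 1)) * (smallSet ω k).indicator 1 n := by
  have hterm : ∀ k, 0 ≤ Real.log (convDen ω (k + 1)) * (smallSet ω k).indicator 1 n := fun k =>
    mul_nonneg (Real.log_nonneg (one_le_convDen ω _))
      (Set.indicator_nonneg (fun _ _ => zero_le_one) _)
  induction M with
  | zero =>
    simpa [convDen_zero] using divisorCost_le_of_lt (one_le_convDen ω 0) (not_le.1 hM)
  | succ M ih =>
    rw [Finset.sum_range_succ]
    by_cases h : n ∈ smallSet ω M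
    · rw [Set.indicator_of_mem h, Pi.one_apply, mul_one]
      have h1 := divisorCost_le_of_lt (one_le_convDen ω (M + 1)) (not_le.1 hM)
      have h2 := Finset.sum_nonneg (s := Finset.range M) fun k _ => hterm k
      linarith
    · linarith [ih h, hterm M]

lemma two_pow_le_fib_sq (n : ℕ) : 2 ^ n ≤ 2 * Nat.fib (n + 1) ^ 2 := by
  induction n using Nat.twoStepInduction with
  | zero => norm_num
  | one => norm_num
  | more n ih1 ih2 =>
    have h1 : Nat.fib (n + 3) = Nat.fib (n + 1) + Nat.fib (n + 2) := Nat.fib_add_two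
    have h2 : Nat.fib (n + 1) ≤ Nat.fib (n + 2) := Nat.fib_le_fib_succ
    change 2 ^ n ≤ 2 * Nat.fib (n + 1) ^ 2 at ih1
    change 2 ^ (n + 2) ≤ 2 * Nat.fib (n + 3) ^ 2
    rw [h1, pow_add]
    nlinarith

/-- The base `2 ^ (-1/4)` of the geometric series that dominates `log q_k / q_k`. -/
def geomBase : ℝ := (2 : ℝ) ^ (-(1 / 4) : ℝ)

lemma geomBase_pos : 0 < geomBase := Real.rpow_pos_of_pos two_pos _

lemma geomBase_lt_one : geomBase < 1 :=
  Real.rpow_lt_one_of_one_lt_of_neg one_lt_two (by norm_num)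

lemma geomBase_pow_four : geomBase ^ 4 = 1 / 2 := by
  rw [geomBase, ← Real.rpow_natCast, ← Real.rpow_mul two_pos.le]
  norm_num [Real.rpow_neg_one]

lemma log_div_convDen_le {ω : ℝ} (hω : Irrational ω) (k : ℕ) :
    Real.log (convDen ω k) / convDen ω k ≤ 4 * geomBase ^ k := by
  set Q := convDen ω k
  have hQ1 : 1 ≤ Q := one_le_convDen ω k
  have hQ0 : 0 < Q := zero_lt_one.trans_le hQ1
  have h1 : Real.log Q ≤ 2 * √Q := by
    have := Real.log_le_sub_one_of_pos (Real.sqrt_pos.2 hQ0)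
    rw [Real.log_sqrt hQ0.le] at this
    linarith
  have h2 : (2 : ℝ) ^ k ≤ 2 * Q ^ 2 := by
    have a : (2 : ℝ) ^ k ≤ 2 * (Nat.fib (k + 1) : ℝ) ^ 2 := by
      exact_mod_cast two_pow_le_fib_sq k
    have b := pow_le_pow_left₀ (Nat.cast_nonneg _) (fib_le_convDen hω k) 2
    linarith
  have h3 : 1 ≤ 2 * √Q * geomBase ^ k := by
    have hpos : 0 ≤ 2 * √Q * geomBase ^ k := by have := geomBase_pos; positivity
    refine (one_le_pow_iff_of_nonneg hpos (n := 4) (by norm_num)).1 ?_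
    have e : (2 * √Q * geomBase ^ k) ^ 4 = 16 * Q ^ 2 * (1 / 2) ^ k := by
      rw [← geomBase_pow_four, mul_pow, mul_pow, ← pow_mul, ← pow_mul, mul_comm k 4,
        show (√Q) ^ 4 = ((√Q) ^ 2) ^ 2 by ring, Real.sq_sqrt hQ0.le]
      norm_num
    rw [e, one_div, inv_pow, ← div_eq_mul_inv, le_div_iff₀ (by positivity)]
    nlinarith
  rw [div_le_iff₀ hQ0]
  have h4 : √Q * √Q = Q := Real.mul_self_sqrt hQ0.le
  have h5 : 0 ≤ 2 * √Q := by positivity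
  calc Real.log Q ≤ 2 * √Q * 1 := by linarith
    _ ≤ 2 * √Q * (2 * √Q * geomBase ^ k) := mul_le_mul_of_nonneg_left h3 h5
    _ = 4 * geomBase ^ k * Q := by linear_combination 4 * geomBase ^ k * h4

/-- The universal constant in the linear bound for the cost of a tree. -/
def costConst : ℝ := Real.log 2 + 16 * (1 - geomBase)⁻¹

/-- The part of the cost that is not in the Brjuno series has a universal bound, since the
denominators grow at least like the Fibonacci numbers. -/
lemma sum_log_div_le {ω : ℝ} (hω : Irrational ω) (M : ℕ) :
    ∑ k ∈ Finset.range M, 4 * (Real.log (convDen ω (k + 1)) / convDen ω (k + 1)) ≤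
      16 * (1 - geomBase)⁻¹ := by
  have hs := summable_geometric_of_lt_one geomBase_pos.le geomBase_lt_one
  calc _ ≤ ∑ k ∈ Finset.range M, 16 * geomBase ^ k := Finset.sum_le_sum fun k _ => by
        have h1 := log_div_convDen_le hω (k + 1)
        have h2 : geomBase ^ (k + 1) ≤ geomBase ^ k :=
          pow_le_pow_of_le_one geomBase_pos.le geomBase_lt_one.le (Nat.le_succ k)
        linarith
    _ = 16 * ∑ k ∈ Finset.range M, geomBase ^ k := by rw [Finset.mul_sum]
    _ ≤ _ := by
        rw [← tsum_geometric_of_lt_one geomBase_pos.le geomBase_lt_one]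
        gcongr
        exact hs.sum_le_tsum _ fun k _ => pow_nonneg geomBase_pos.le k

lemma sum_brjuno_le {ω : ℝ} (hB : brjunoFunction ω ≠ ⊤) (M : ℕ) :
    ∑ k ∈ Finset.range M, Real.log (convDen ω (k + 1)) / convDen ω k ≤
      (brjunoFunction ω).toReal := by
  rw [← ENNReal.ofReal_le_iff_le_toReal hB,
    ENNReal.ofReal_sum_of_nonneg fun k _ => brjuno_term_nonneg ω k]
  exact ENNReal.sum_le_tsum _

/-- The total cost of a tree is at most its size times the Brjuno function, up to a universal
constant. The scale-`k` part contributes `log q_{k+1} (1 / q_k + 4 / q_{k+1})` per unit of size;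
its main term is a term of the Brjuno series with coefficient exactly one. -/
lemma weight_divisorCost_le {ω : ℝ} (hω : Irrational ω) (hB : brjunoFunction ω ≠ ⊤)
    (t : DivisorTree) :
    t.weight (divisorCost ω) ≤ ((brjunoFunction ω).toReal + costConst) * t.size := by
  -- Only finitely many indices occur in `t`, so none of them is small at a fine enough scale.
  obtain ⟨M, hM⟩ : ∃ M, ∀ j, 1 ≤ j → j ≤ t.size → j ∉ smallSet ω M := by
    have htend : Filter.Tendsto (fun k => 1 / (8 * convDen ω k)) Filter.atTop (nhds 0) := by
      have h2 : Filter.Tendsto (fun k => 8 * convDen ω k) Filter.atTop Filter.atTop := by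
        refine Filter.Tendsto.const_mul_atTop (by norm_num) ?_
        refine Filter.tendsto_atTop_mono (fun k => ?_)
          (tendsto_natCast_atTop_atTop (R := ℝ) |>.comp
            (Filter.tendsto_sub_atTop_nat 5))
        refine le_trans ?_ (fib_le_convDen hω k)
        change ((k - 5 : ℕ) : ℝ) ≤ _
        rcases Nat.lt_or_ge k 5 with h | h
        · rw [Nat.sub_eq_zero_of_le h.le]; simp
        · exact_mod_cast (by omega : k - 5 ≤ k + 1).trans (Nat.le_fib_self (by omega))
      simp only [one_div]
      exact h2.inv_tendsto_atTop
    have hev : ∀ᶠ k in Filter.atTop, ∀ j ∈ Finset.Icc 1 t.size,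
        1 / (8 * convDen ω k) < distInt ω j := by
      rw [Filter.eventually_all_finset]
      intro j hj
      exact htend.eventually_lt_const (distInt_pos hω (Finset.mem_Icc.1 hj).1)
    obtain ⟨M, hM⟩ := hev.exists
    exact ⟨M, fun j h1 h2 h3 => (hM j (Finset.mem_Icc.2 ⟨h1, h2⟩)).not_ge h3⟩
  have h1 := t.weight_le_sum (Finset.range M) (fun k => Real.log (convDen ω (k + 1)))
    (fun k => (smallSet ω k).indicator 1) (divisorCost ω) (Real.log 2)
    fun j hj1 hj2 => divisorCost_le_sum M (hM j hj1 hj2)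
  have h2 : ∀ k, t.weight ((smallSet ω k).indicator 1) ≤
      t.size * (1 / convDen ω k + 4 / convDen ω (k + 1)) := by
    intro k
    obtain ⟨p, q, hq, hqc, -⟩ := exists_convergent hω k
    obtain ⟨h0, hA⟩ := smallSet_dvd hω k hqc
    have hE : 0 < convDen ω (k + 1) / 2 :=
      half_pos (zero_lt_one.trans_le (one_le_convDen ω _))
    have := t.weight_indicator_le hq hE h0 hA
    rw [hqc] at this
    convert this using 3
    field_simp
    norm_num
  have h3 : ∀ k, Real.log (convDen ω (k + 1)) * t.weight ((smallSet ω k).indicator 1) ≤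
      t.size * (Real.log (convDen ω (k + 1)) / convDen ω k +
        4 * (Real.log (convDen ω (k + 1)) / convDen ω (k + 1))) := fun k =>
    (mul_le_mul_of_nonneg_left (h2 k) (Real.log_nonneg (one_le_convDen ω _))).trans
      (le_of_eq (by ring))
  have h4 := Finset.sum_le_sum (s := Finset.range M) fun k _ => h3 k
  rw [← Finset.mul_sum, Finset.sum_add_distrib] at h4
  have h5 := add_le_add (sum_brjuno_le hB M) (sum_log_div_le hω M)
  have h6 := mul_le_mul_of_nonneg_left h5 (Nat.cast_nonneg (α := ℝ) t.size)
  rw [costConst]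
  linarith

/-! ### The majorant for the formal linearization -/

lemma sum_range_inv_sq_le (N : ℕ) :
    ∑ i ∈ Finset.range (N + 2), (1 / (i : ℝ) ^ 2) ≤
      2 - 1 / ((N : ℝ) + 1) := by
  induction N with
  | zero => norm_num [Finset.sum_range_succ]
  | succ N ih =>
    rw [Finset.sum_range_succ]
    have : 1 / (((N + 2 : ℕ) : ℝ)) ^ 2 ≤ 1 / (N + 1) - 1 / (((N + 1 : ℕ) : ℝ) + 1) := by
      push_cast
      rw [div_sub_div _ _ (by positivity) (by positivity), div_le_div_iff₀ (by positivity)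
        (by positivity)]
      nlinarith [Nat.cast_nonneg (α := ℝ) N]
    linarith

lemma sum_antidiagonal_inv_sq_le (l : ℕ) :
    ∑ p ∈ Finset.HasAntidiagonal.antidiagonal l, (1 / ((p.1 : ℝ) ^ 2 * (p.2 : ℝ) ^ 2)) ≤
      8 / (l : ℝ) ^ 2 := by
  have hsum : ∑ i ∈ Finset.range (l + 1), (1 / (i : ℝ) ^ 2) ≤ 2 := by
    have h1 := sum_range_inv_sq_le l
    rw [Finset.sum_range_succ] at h1
    have : (0 : ℝ) ≤ 1 / ((l + 1 : ℕ) : ℝ) ^ 2 := by positivity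
    have : (0 : ℝ) ≤ 1 / ((l : ℝ) + 1) := by positivity
    linarith
  have hterm : ∀ p ∈ Finset.HasAntidiagonal.antidiagonal l, 1 / ((p.1 : ℝ) ^ 2 * (p.2 : ℝ) ^ 2) ≤
      2 / (l : ℝ) ^ 2 * (1 / (p.1 : ℝ) ^ 2 + 1 / (p.2 : ℝ) ^ 2) := by
    rintro ⟨a, b⟩ hp
    have hl : (l : ℝ) = a + b := by
      exact_mod_cast (Finset.HasAntidiagonal.mem_antidiagonal.1 hp).symm
    rcases Nat.eq_zero_or_pos a with rfl | ha
    · simp only [Nat.cast_zero, ne_eq, OfNat.ofNat_ne_zero, not_false_eq_true, zero_pow, zero_mul,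
        div_zero]
      positivity
    rcases Nat.eq_zero_or_pos b with rfl | hb
    · simp only [Nat.cast_zero, ne_eq, OfNat.ofNat_ne_zero, not_false_eq_true, zero_pow, mul_zero,
        div_zero]
      positivity
    have ha' : (0 : ℝ) < a := by exact_mod_cast ha
    have hb' : (0 : ℝ) < b := by exact_mod_cast hb
    rw [hl, div_add_div _ _ (by positivity) (by positivity), div_mul_div_comm,
      div_le_div_iff₀ (by positivity) (by positivity)]
    have : 0 ≤ (a : ℝ) ^ 2 * (b : ℝ) ^ 2 * ((a : ℝ) - b) ^ 2 := by positivity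
    nlinarith
  have hrefl : ∑ i ∈ Finset.range (l + 1), (1 / ((l - i : ℕ) : ℝ) ^ 2) ≤ 2 := by
    refine le_of_eq_of_le ?_ hsum
    rw [← Finset.sum_range_reflect (fun i : ℕ => 1 / (i : ℝ) ^ 2) (l + 1)]
    exact Finset.sum_congr rfl fun i _ => by rw [add_tsub_cancel_right]
  refine (Finset.sum_le_sum hterm).trans ?_
  rw [← Finset.mul_sum, Finset.sum_add_distrib,
    Finset.Nat.sum_antidiagonal_eq_sum_range_succ_mk,
    Finset.Nat.sum_antidiagonal_eq_sum_range_succ_mk]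
  exact (mul_le_mul_of_nonneg_left (add_le_add hsum hrefl) (by positivity)).trans
    (le_of_eq (by ring))

lemma coeff_pow_eq_zero {H : PowerSeries ℂ} (h0 : PowerSeries.coeff 0 H = 0) {n m : ℕ}
    (h : n < m) : PowerSeries.coeff n (H ^ m) = 0 := by
  have hX : (PowerSeries.X : PowerSeries ℂ) ∣ H := PowerSeries.X_dvd_iff.2 (by simpa using h0)
  exact PowerSeries.X_pow_dvd_iff.1 (pow_dvd_pow_of_dvd hX m) n h

/-- Coefficients bounded by `α ^ (j - 1) e ^ D (j - 1) / j²`, with `D` superadditive, give bounds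
of the same shape for the powers of a power series; the factors `1 / j²` make the bound stable
under convolution. Only the coefficients of degree below `n` that enter are assumed bounded. -/
lemma norm_coeff_pow_le {H : PowerSeries ℂ} (h0 : PowerSeries.coeff 0 H = 0) {α : ℝ} (hα : 0 < α)
    {D : ℕ → ℝ} (hD : ∀ a b, D a + D b ≤ D (a + b)) {n : ℕ}
    (hn : ∀ j, 1 ≤ j → j < n → ‖PowerSeries.coeff j H‖ ≤
      α ^ (j - 1) * Real.exp (D (j - 1)) / (j : ℝ) ^ 2) (m : ℕ) :
    ∀ l, l < n + m → m + 1 ≤ l → ‖PowerSeries.coeff l (H ^ (m + 1))‖ ≤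
      8 ^ m * α ^ (l - (m + 1)) * Real.exp (D (l - (m + 1))) / (l : ℝ) ^ 2 := by
  induction m with
  | zero =>
    intro l hl hl1
    simp only [zero_add, pow_one, pow_zero, one_mul]
    exact hn l hl1 hl
  | succ m ih =>
    intro l hl hl1
    set K : ℝ := 8 ^ m * α ^ (l - (m + 1 + 1)) * Real.exp (D (l - (m + 1 + 1)))
    have hK : 0 ≤ K := by positivity
    rw [pow_succ, PowerSeries.coeff_mul]
    have hterm : ∀ p ∈ Finset.HasAntidiagonal.antidiagonal l,
        ‖PowerSeries.coeff p.1 (H ^ (m + 1)) * PowerSeries.coeff p.2 H‖ ≤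
          K * (1 / ((p.1 : ℝ) ^ 2 * (p.2 : ℝ) ^ 2)) := by
      rintro ⟨a, b⟩ hp
      have hab : a + b = l := Finset.HasAntidiagonal.mem_antidiagonal.1 hp
      change ‖PowerSeries.coeff a (H ^ (m + 1)) * PowerSeries.coeff b H‖ ≤
          K * (1 / ((a : ℝ) ^ 2 * (b : ℝ) ^ 2))
      have hR : 0 ≤ K * (1 / ((a : ℝ) ^ 2 * (b : ℝ) ^ 2)) := by positivity
      rcases Nat.lt_or_ge a (m + 1) with ha | ha
      · rw [coeff_pow_eq_zero h0 ha, zero_mul, norm_zero]; exact hR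
      rcases Nat.eq_zero_or_pos b with rfl | hb
      · rw [h0, mul_zero, norm_zero]; exact hR
      have h1 := ih a (by omega) ha
      have h2 := hn b hb (by omega)
      have hexp : Real.exp (D (a - (m + 1))) * Real.exp (D (b - 1)) ≤
          Real.exp (D (l - (m + 1 + 1))) := by
        rw [← Real.exp_add, Real.exp_le_exp]
        refine (hD _ _).trans (le_of_eq ?_)
        congr 1; omega
      have hpow : α ^ (l - (m + 1 + 1)) = α ^ (a - (m + 1)) * α ^ (b - 1) := by
        rw [← pow_add]; congr 1; omega
      rw [norm_mul]
      calc _ ≤ (8 ^ m * α ^ (a - (m + 1)) * Real.exp (D (a - (m + 1))) / (a : ℝ) ^ 2) *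
            (α ^ (b - 1) * Real.exp (D (b - 1)) / (b : ℝ) ^ 2) := by gcongr
        _ = 8 ^ m * (α ^ (a - (m + 1)) * α ^ (b - 1)) *
            (Real.exp (D (a - (m + 1))) * Real.exp (D (b - 1))) *
              (1 / ((a : ℝ) ^ 2 * (b : ℝ) ^ 2)) := by ring
        _ ≤ 8 ^ m * (α ^ (a - (m + 1)) * α ^ (b - 1)) *
            Real.exp (D (l - (m + 1 + 1))) * (1 / ((a : ℝ) ^ 2 * (b : ℝ) ^ 2)) := by gcongr
        _ = _ := by rw [← hpow]
    refine (norm_sum_le_of_le _ hterm).trans ?_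
    rw [← Finset.mul_sum]
    refine (mul_le_mul_of_nonneg_left (sum_antidiagonal_inv_sq_le l) hK).trans (le_of_eq ?_)
    simp only [K]
    ring

lemma sum_Icc_two_half_pow_le (n : ℕ) :
    ∑ m ∈ Finset.Icc 2 n, (1 / 2 : ℝ) ^ (m - 1) ≤ 1 := by
  have h : ∀ n, ∑ m ∈ Finset.Ico 2 (n + 2), (1 / 2 : ℝ) ^ (m - 1) = 1 - (1 / 2) ^ n := by
    intro n
    induction n with
    | zero => simp
    | succ n ih =>
      rw [Finset.sum_Ico_succ_top (by omega), ih, show n + 2 - 1 = n + 1 by omega]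
      ring
  have h1 := h n
  refine (Finset.sum_le_sum_of_subset_of_nonneg (t := Finset.Ico 2 (n + 2)) ?_
    fun _ _ _ => by positivity).trans (h1.trans_le ?_)
  · intro m hm
    rw [Finset.mem_Icc] at hm
    rw [Finset.mem_Ico]; omega
  · linarith [pow_pos (by norm_num : (0 : ℝ) < 1 / 2) n]

/-- The bound for the formal linearization in terms of the accumulated cost `D` of the small
divisors. -/
theorem norm_coeff_linearization_le {F H : PowerSeries ℂ} (hH : IsLinearization F H)
    (hF0 : PowerSeries.coeff 0 F = 0) (hlam : ‖PowerSeries.coeff 1 F‖ = 1)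
    (hne : ∀ n : ℕ, 2 ≤ n → PowerSeries.coeff 1 F ^ n ≠ PowerSeries.coeff 1 F)
    {c : ℝ} (hc : 0 < c) (hF : ∀ m, 2 ≤ m → ‖PowerSeries.coeff m F‖ ≤ c ^ (m - 1))
    {D l : ℕ → ℝ} (hD0 : 0 ≤ D 0) (hD : ∀ a b, D a + D b ≤ D (a + b))
    (hDl : ∀ n, D n + l (n + 1) ≤ D (n + 1)) (hl0 : ∀ n, 0 ≤ l n)
    (hl : ∀ n, -Real.log ‖PowerSeries.coeff 1 F ^ n - 1‖ ≤ l n) (n : ℕ) (hn : 1 ≤ n) :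
    ‖PowerSeries.coeff n H‖ ≤ (16 * c) ^ (n - 1) * Real.exp (D (n - 1)) / (n : ℝ) ^ 2 := by
  obtain ⟨h0, h1, hrec⟩ := (isLinearization_iff F H hF0 hne).1 hH
  have hmono : Monotone D := monotone_nat_of_le_succ fun n => by linarith [hDl n, hl0 (n + 1)]
  induction n using Nat.strong_induction_on with
  | _ n ih =>
    rcases Nat.lt_or_ge n 2 with hn2 | hn2
    · obtain rfl : n = 1 := by omega
      simp [h1, hD0]
    rw [hrec n hn2, norm_mul, norm_inv]
    have hdiv : ‖PowerSeries.coeff 1 F ^ n - PowerSeries.coeff 1 F‖⁻¹ ≤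
        Real.exp (l (n - 1)) := by
      obtain ⟨k, rfl⟩ : ∃ k, n = k + 1 := ⟨n - 1, by omega⟩
      have e : PowerSeries.coeff 1 F ^ (k + 1) - PowerSeries.coeff 1 F =
          PowerSeries.coeff 1 F * (PowerSeries.coeff 1 F ^ k - 1) := by ring
      have hpos : 0 < ‖PowerSeries.coeff 1 F ^ k - 1‖ := by
        rw [norm_pos_iff]
        intro h
        exact hne _ hn2 (sub_eq_zero.1 (by rw [e, h, mul_zero]))
      rw [e, norm_mul, hlam, one_mul, add_tsub_cancel_right,
        ← Real.exp_log (inv_pos.2 hpos), Real.log_inv, Real.exp_le_exp]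
      exact hl k
    have hsum : ‖higherPart F H n‖ ≤
        (16 * c) ^ (n - 1) * Real.exp (D (n - 2)) / (n : ℝ) ^ 2 := by
      have hterm : ∀ m ∈ Finset.Icc 2 n,
          ‖PowerSeries.coeff m F * PowerSeries.coeff n (H ^ m)‖ ≤
            (16 * c) ^ (n - 1) * Real.exp (D (n - 2)) / (n : ℝ) ^ 2 * (1 / 2) ^ (m - 1) := by
        intro m hm
        obtain ⟨hm2, hmn⟩ := Finset.mem_Icc.1 hm
        have hpow := norm_coeff_pow_le h0 (α := 16 * c) (by positivity) hD
          (fun j hj1 hjn => ih j hjn hj1) (m - 1) n (by omega) (by omega)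
        rw [show m - 1 + 1 = m by omega] at hpow
        have hexp : Real.exp (D (n - m)) ≤ Real.exp (D (n - 2)) :=
          Real.exp_le_exp.2 (hmono (by omega))
        have e : c ^ (m - 1) * (8 ^ (m - 1) * (16 * c) ^ (n - m)) =
            (16 * c) ^ (n - 1) * (1 / 2) ^ (m - 1) := by
          rw [show n - 1 = (m - 1) + (n - m) by omega, pow_add, ← mul_assoc, ← mul_pow,
            mul_right_comm, ← mul_pow]
          ring
        rw [norm_mul]
        calc _ ≤ c ^ (m - 1) * (8 ^ (m - 1) * (16 * c) ^ (n - m) * Real.exp (D (n - m)) /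
              (n : ℝ) ^ 2) := by gcongr; exact hF m hm2
          _ ≤ c ^ (m - 1) * (8 ^ (m - 1) * (16 * c) ^ (n - m) * Real.exp (D (n - 2)) /
              (n : ℝ) ^ 2) := by gcongr
          _ = (c ^ (m - 1) * (8 ^ (m - 1) * (16 * c) ^ (n - m))) * Real.exp (D (n - 2)) /
              (n : ℝ) ^ 2 := by ring
          _ = _ := by rw [e]; ring
      refine (norm_sum_le_of_le _ hterm).trans ?_
      rw [← Finset.mul_sum]
      exact mul_le_of_le_one_right (by positivity) (sum_Icc_two_half_pow_le n)
    have hexp : Real.exp (l (n - 1)) * Real.exp (D (n - 2)) ≤ Real.exp (D (n - 1)) := by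
      rw [← Real.exp_add, Real.exp_le_exp]
      have := hDl (n - 2)
      rw [show n - 2 + 1 = n - 1 by omega] at this
      linarith
    calc _ ≤ Real.exp (l (n - 1)) *
          ((16 * c) ^ (n - 1) * Real.exp (D (n - 2)) / (n : ℝ) ^ 2) := by gcongr
      _ = (16 * c) ^ (n - 1) * (Real.exp (l (n - 1)) * Real.exp (D (n - 2))) / (n : ℝ) ^ 2 := by
          ring
      _ ≤ _ := by gcongr

/-! ### A universal bound for univalent functions -/

open Metric in
/-- A form of Bloch's theorem: if the image of a disk of radius `R` contains no disk of radius `s`,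
the derivative at the centre is at most `48 s / R`. As in Landau's proof, one passes to a point
where `|h'(z)| (R - |z - a|)` is maximal; near it `h` is close to its linear part. -/
theorem norm_deriv_mul_le_of_not_ball_subset {h : ℂ → ℂ} {U : Set ℂ} (hU : IsOpen U)
    (hh : DifferentiableOn ℂ h U) {a : ℂ} {R s : ℝ} (hR : 0 < R) (hs0 : 0 < s)
    (haR : closedBall a R ⊆ U) (hs : ∀ w, ¬ ball w s ⊆ h '' closedBall a R) :
    ‖deriv h a‖ * R ≤ 48 * s := by
  have hd : DifferentiableOn ℂ (deriv h) U := hh.deriv hU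
  have hcont : ContinuousOn (fun z => ‖deriv h z‖ * (R - dist z a)) (closedBall a R) :=
    ((hd.continuousOn.mono haR).norm).mul
      (continuousOn_const.sub (continuous_id.dist continuous_const).continuousOn)
  obtain ⟨z₀, hz₀, hmax⟩ := (isCompact_closedBall a R).exists_isMaxOn
    ⟨a, mem_closedBall_self hR.le⟩ hcont
  have hmax' : ∀ z ∈ closedBall a R,
      ‖deriv h z‖ * (R - dist z a) ≤ ‖deriv h z₀‖ * (R - dist z₀ a) := fun z hz => hmax hz
  have ha := hmax' a (mem_closedBall_self hR.le)
  rw [dist_self, sub_zero] at ha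
  set M := ‖deriv h z₀‖
  obtain ⟨ρ, hρ⟩ : ∃ ρ, R - dist z₀ a = 2 * ρ := ⟨(R - dist z₀ a) / 2, by ring⟩
  rw [hρ] at ha hmax'
  have hρ0 : 0 ≤ ρ := by linarith [mem_closedBall.1 hz₀]
  rcases hρ0.eq_or_lt with hρ0 | hρ0
  · rw [← hρ0] at ha; linarith
  rcases (norm_nonneg (deriv h z₀)).eq_or_lt with hM | hM
  · rw [show M = 0 from hM.symm] at ha; linarith
  have hsub : ball z₀ ρ ⊆ closedBall a R := fun z hz => by
    rw [mem_closedBall]; linarith [dist_triangle z z₀ a, mem_ball.1 hz]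
  have hb : ∀ z ∈ ball z₀ ρ, ‖deriv h z‖ ≤ 2 * M := by
    intro z hz
    have h1 := hmax' z (hsub hz)
    have h2 : ρ ≤ R - dist z a := by linarith [dist_triangle z z₀ a, mem_ball.1 hz]
    have h3 := mul_le_mul_of_nonneg_left h2 (norm_nonneg (deriv h z))
    refine le_of_mul_le_mul_right ?_ hρ0
    linarith
  have hsch : ∀ z ∈ closedBall z₀ (ρ / 6), ‖deriv h z - deriv h z₀‖ ≤ M / 2 := by
    intro z hz
    have hz' := mem_closedBall.1 hz
    have h1 := Complex.dist_le_div_mul_dist_of_mapsTo_ball (R₁ := ρ) (R₂ := 3 * M) (z := z)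
      (hd.mono (hsub.trans haR)) (fun w hw => by
        rw [mem_closedBall, dist_eq_norm]
        refine (norm_sub_le _ _).trans ?_
        change ‖deriv h w‖ + M ≤ _
        linarith [hb w hw]) (mem_ball.2 (by linarith))
    rw [dist_eq_norm] at h1
    refine h1.trans ((mul_le_mul_of_nonneg_left hz' (by positivity)).trans (le_of_eq ?_))
    field_simp
    ring
  have hsub6 : closedBall z₀ (ρ / 6) ⊆ ball z₀ ρ := closedBall_subset_ball (by linarith)
  have hat : ∀ z ∈ closedBall z₀ (ρ / 6), HasDerivAt h (deriv h z) z := fun z hz =>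
    (hh.differentiableAt (hU.mem_nhds (haR (hsub (hsub6 hz))))).hasDerivAt
  have hlin : ∀ z ∈ sphere z₀ (ρ / 6), M * ρ / 12 ≤ ‖h z - h z₀‖ := by
    intro z hz
    have h1 := (convex_closedBall z₀ (ρ / 6)).norm_image_sub_le_of_norm_hasDerivWithin_le
      (f := fun z => h z - deriv h z₀ * z) (f' := fun z => deriv h z - deriv h z₀) (C := M / 2)
      (fun w hw => ((hat w hw).sub (((hasDerivAt_id w).const_mul (deriv h z₀)).congr_deriv
        (mul_one _))).hasDerivWithinAt)
      hsch (mem_closedBall_self (by linarith)) (sphere_subset_closedBall hz)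
    have hz' : ‖z - z₀‖ = ρ / 6 := mem_sphere_iff_norm.1 hz
    have h2 : deriv h z₀ * (z - z₀) = (h z - h z₀) -
        ((h z - deriv h z₀ * z) - (h z₀ - deriv h z₀ * z₀)) := by ring
    have h3 : M * ‖z - z₀‖ ≤ ‖h z - h z₀‖ + M / 2 * ‖z - z₀‖ := by
      rw [← norm_mul, h2]
      exact (norm_sub_le _ _).trans (add_le_add le_rfl h1)
    rw [hz'] at h3
    linarith
  have himg : ball (h z₀) (M * ρ / 12 / 2) ⊆ h '' closedBall z₀ (ρ / 6) := by
    refine DiffContOnCl.ball_subset_image_closedBall ?_ (by linarith) hlin ?_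
    · refine DifferentiableOn.diffContOnCl ?_
      rw [closure_ball _ (by linarith)]
      exact fun z hz => (hat z hz).differentiableAt.differentiableWithinAt
    · have := ((hat z₀ (mem_closedBall_self (by linarith))).eventually_ne (c := h z₀)
        (norm_pos_iff.1 hM)).frequently
      exact this.filter_mono nhdsWithin_le_nhds
  have hlt : M * ρ / 12 / 2 < s := by
    by_contra hcon
    exact hs (h z₀) ((ball_subset_ball (not_lt.1 hcon)).trans
      (himg.trans (Set.image_mono (hsub6.trans hsub))))
  linarith

open Metric in
/-- A univalent function on the unit disk with `f 0 = 0` and `|f' 0| = 1` omits a value of modulus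
at most two: otherwise the maximum principle for `z / f z` on the domain `|f| < 2` fails. -/
lemma exists_omitted_value {f : ℂ → ℂ} (hf : AnalyticOnNhd ℂ f (ball 0 1))
    (hinj : Set.InjOn f (ball 0 1)) (h0 : f 0 = 0) (h1 : ‖deriv f 0‖ = 1) :
    ∃ w, ‖w‖ ≤ 2 ∧ w ≠ 0 ∧ ∀ z ∈ ball (0 : ℂ) 1, f z ≠ w := by
  have h0mem : (0 : ℂ) ∈ ball (0 : ℂ) 1 := mem_ball_self one_pos
  suffices ¬ closedBall (0 : ℂ) 2 ⊆ f '' ball 0 1 by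
    obtain ⟨w, hw, hw'⟩ := Set.not_subset.1 this
    refine ⟨w, by simpa using hw, ?_, fun z hz hzw => hw' ⟨z, hz, hzw⟩⟩
    rintro rfl
    exact hw' ⟨0, h0mem, h0⟩
  intro hsub
  have hopen : ∀ s ⊆ ball (0 : ℂ) 1, IsOpen s → IsOpen (f '' s) := by
    refine (hf.is_constant_or_isOpen (convex_ball 0 1).isPreconnected).resolve_left ?_
    rintro ⟨w, hw⟩
    have hmem : (1 / 2 : ℂ) ∈ ball (0 : ℂ) 1 := by simp; norm_num
    have := hinj hmem h0mem ((hw _ hmem).trans (hw _ h0mem).symm)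
    norm_num at this
  have hemb : Topology.IsOpenEmbedding ((ball (0 : ℂ) 1).domRestrict f) := by
    refine .of_continuous_injective_isOpenMap hf.continuousOn.domRestrict hinj.injective ?_
    intro s hs
    have := hopen (Subtype.val '' s) (by rintro _ ⟨z, -, rfl⟩; exact z.2)
      (isOpen_ball.isOpenMap_subtype_val s hs)
    rwa [Set.image_image] at this
  have hK : IsCompact (Subtype.val '' ((ball (0 : ℂ) 1).domRestrict f ⁻¹' closedBall 0 2)) := by
    refine IsCompact.image ?_ continuous_subtype_val
    refine (hemb.isInducing.isCompact_preimage_iff ?_).2 (isCompact_closedBall 0 2)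
    rwa [Set.range_domRestrict]
  set K := Subtype.val '' ((ball (0 : ℂ) 1).domRestrict f ⁻¹' closedBall 0 2)
  have hKmem : ∀ z ∈ K, z ∈ ball (0 : ℂ) 1 ∧ ‖f z‖ ≤ 2 := by
    rintro _ ⟨z, hz, rfl⟩
    exact ⟨z.2, mem_closedBall_zero_iff.1 hz⟩
  set V := ball (0 : ℂ) 1 ∩ f ⁻¹' ball 0 2
  have hV : IsOpen V := hf.continuousOn.isOpen_inter_preimage isOpen_ball isOpen_ball
  have hVK : closure V ⊆ K := by
    refine closure_minimal ?_ hK.isClosed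
    rintro z ⟨hz, hz'⟩
    exact ⟨⟨z, hz⟩, ball_subset_closedBall hz', rfl⟩
  have hg : DifferentiableOn ℂ (dslope f 0) (ball 0 1) :=
    (Complex.differentiableOn_dslope (isOpen_ball.mem_nhds h0mem)).2 hf.differentiableOn
  have hg0 : ∀ z, z ≠ 0 → dslope f 0 z = f z / z := fun z hz => by
    rw [dslope_of_ne _ hz, slope_def_field, h0, sub_zero, sub_zero]
  have hgne : ∀ z ∈ ball (0 : ℂ) 1, dslope f 0 z ≠ 0 := by
    intro z hz
    rcases eq_or_ne z 0 with rfl | hz0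
    · rw [dslope_same, ← norm_pos_iff, h1]; exact one_pos
    · rw [hg0 z hz0]
      refine div_ne_zero (fun h => hz0 (hinj hz h0mem (h.trans h0.symm))) hz0
  have hmax := Complex.norm_le_of_forall_mem_frontier_norm_le (U := V)
    (f := fun z => (dslope f 0 z)⁻¹) (C := 1 / 2) (z := 0)
    (isBounded_ball.subset Set.inter_subset_left)
    (DifferentiableOn.diffContOnCl (fun z hz =>
      ((hg.differentiableAt (isOpen_ball.mem_nhds (hKmem z (hVK hz)).1)).inv
        (hgne z (hKmem z (hVK hz)).1)).differentiableWithinAt))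
    (fun z hz => by
      rw [hV.frontier_eq] at hz
      obtain ⟨hzb, hz2⟩ := hKmem z (hVK hz.1)
      have hz2' : ‖f z‖ = 2 := by
        refine le_antisymm hz2 (not_lt.1 fun hlt => hz.2 ⟨hzb, ?_⟩)
        simpa using hlt
      have hz0 : z ≠ 0 := by
        rintro rfl
        rw [h0] at hz2'; norm_num at hz2'
      rw [hg0 z hz0, inv_div, norm_div, hz2']
      have : ‖z‖ < 1 := by simpa using hzb
      linarith)
    (subset_closure ⟨h0mem, by simp [h0]⟩)
  rw [dslope_same, norm_inv, h1] at hmax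
  norm_num at hmax

open Metric in
lemma exists_log_of_ne_zero {g : ℂ → ℂ} (hg : DifferentiableOn ℂ g (ball 0 1))
    (hne : ∀ z ∈ ball (0 : ℂ) 1, g z ≠ 0) (h0 : g 0 = 1) :
    ∃ L : ℂ → ℂ, DifferentiableOn ℂ L (ball 0 1) ∧ L 0 = 0 ∧
      ∀ z ∈ ball (0 : ℂ) 1, Complex.exp (L z) = g z := by
  have h0mem : (0 : ℂ) ∈ ball (0 : ℂ) 1 := mem_ball_self one_pos
  obtain ⟨P, hP⟩ := ((hg.deriv isOpen_ball).div hg hne).isExactOn_ball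
  have hat : ∀ z ∈ ball (0 : ℂ) 1,
      HasDerivAt (fun z => Complex.exp (-(P z - P 0)) * g z) 0 z := fun z hz => by
    have h1 := (((hP z hz).sub_const (P 0)).neg.cexp).mul
      (hg.differentiableAt (isOpen_ball.mem_nhds hz)).hasDerivAt
    refine h1.congr_deriv ?_
    have := hne z hz
    simp only [Pi.div_apply]
    field_simp
    ring
  refine ⟨fun z => P z - P 0, fun z hz =>
    ((hP z hz).differentiableAt.sub_const _).differentiableWithinAt, sub_self _, fun z hz => ?_⟩
  have hconst := isOpen_ball.is_const_of_deriv_eq_zero (convex_ball 0 1).isPreconnected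
    (fun z hz => (hat z hz).differentiableAt.differentiableWithinAt)
    (fun z hz => (hat z hz).deriv) hz h0mem
  simp only [sub_self, neg_zero, Complex.exp_zero, h0, mul_one] at hconst
  rw [Complex.exp_neg, inv_mul_eq_one₀ (Complex.exp_ne_zero _)] at hconst
  exact hconst

open Metric in
/-- Univalent functions, normalized up to rotation, are uniformly bounded on the half disk. For an
omitted value `w`, the image of a logarithm of `1 - f / w` is disjoint from its translate by
`2πi`, so it contains no disk of radius `4`, and Bloch's theorem bounds its derivative. -/
theorem norm_le_of_univalent {f : ℂ → ℂ} (hf : AnalyticOnNhd ℂ f (ball 0 1))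
    (hinj : Set.InjOn f (ball 0 1)) (h0 : f 0 = 0) (h1 : ‖deriv f 0‖ = 1) {z : ℂ}
    (hz : ‖z‖ ≤ 1 / 2) : ‖f z‖ ≤ 2 * (1 + Real.exp 384) := by
  obtain ⟨w, hw2, hw0, hw⟩ := exists_omitted_value hf hinj h0 h1
  obtain ⟨L, hL, hL0, hexp⟩ := exists_log_of_ne_zero (g := fun z => 1 - f z / w)
    ((differentiableOn_const 1).sub (hf.differentiableOn.div_const w))
    (fun z hz h => hw z hz (by rw [sub_eq_zero, eq_div_iff hw0, one_mul] at h; exact h.symm))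
    (by simp [h0])
  have hnb : ∀ A ⊆ ball (0 : ℂ) 1, ∀ c, ¬ ball c 4 ⊆ L '' A := by
    intro A hA c hc
    have hpi : ‖(Real.pi * Complex.I : ℂ)‖ < 4 := by
      simp [abs_of_pos Real.pi_pos, Real.pi_lt_four]
    obtain ⟨z₁, hz₁, e₁⟩ := hc (show c + Real.pi * Complex.I ∈ ball c 4 by
      simpa [mem_ball, dist_eq_norm] using hpi)
    obtain ⟨z₂, hz₂, e₂⟩ := hc (show c - Real.pi * Complex.I ∈ ball c 4 by
      simpa [mem_ball, dist_eq_norm] using hpi)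
    have e : L z₁ = L z₂ + 2 * Real.pi * Complex.I := by rw [e₁, e₂]; ring
    have he : Complex.exp (L z₁) = Complex.exp (L z₂) := by
      rw [e, Complex.exp_add, Complex.exp_two_pi_mul_I, mul_one]
    rw [hexp z₁ (hA hz₁), hexp z₂ (hA hz₂)] at he
    have hff : f z₁ = f z₂ := by
      field_simp at he
      linear_combination -he
    rw [hinj (hA hz₁) (hA hz₂) hff] at e
    exact Complex.two_pi_I_ne_zero (by linear_combination -e)
  have hLd : ∀ a ∈ closedBall (0 : ℂ) (1 / 2), ‖deriv L a‖ ≤ 768 := by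
    intro a ha
    have hsub : closedBall a (1 / 4) ⊆ ball (0 : ℂ) 1 := fun x hx => by
      rw [mem_ball]
      linarith [dist_triangle x a 0, mem_closedBall.1 hx, mem_closedBall.1 ha]
    have := norm_deriv_mul_le_of_not_ball_subset isOpen_ball hL (a := a) (R := 1 / 4) (s := 4)
      (by norm_num) (by norm_num) hsub (hnb _ hsub)
    linarith
  have hz' : z ∈ closedBall (0 : ℂ) (1 / 2) := by simpa using hz
  have hsub : closedBall (0 : ℂ) (1 / 2) ⊆ ball 0 1 := closedBall_subset_ball (by norm_num)
  have hLz : ‖L z‖ ≤ 384 := by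
    have := (convex_closedBall (0 : ℂ) (1 / 2)).norm_image_sub_le_of_norm_deriv_le
      (fun x hx => hL.differentiableAt (isOpen_ball.mem_nhds (hsub hx))) hLd
      (mem_closedBall_self (by norm_num)) hz'
    rw [hL0, sub_zero, sub_zero] at this
    linarith
  have hfz : f z = w * (1 - Complex.exp (L z)) := by
    rw [hexp z (hsub hz')]
    field_simp
    ring
  rw [hfz, norm_mul]
  refine mul_le_mul hw2 ((norm_sub_le _ _).trans ?_) (norm_nonneg _) (by norm_num)
  rw [norm_one]
  gcongr
  refine (Complex.norm_exp_le_exp_norm _).trans (Real.exp_le_exp.2 hLz)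

/-- The universal constant `c` with `|f_m| ≤ c ^ (m - 1)` for the Taylor coefficients of a
univalent function. -/
def coeffConst : ℝ := 4 * (2 * (1 + Real.exp 384))

lemma norm_multiplier (ω : ℝ) : ‖multiplier ω‖ = 1 := by
  rw [multiplier, show (2 * Real.pi * Complex.I * ω : ℂ) = ((2 * Real.pi * ω : ℝ) : ℂ) * Complex.I
    by push_cast; ring]
  exact Complex.norm_exp_ofReal_mul_I _

open Metric in
lemma norm_coeff_taylorSeries_le {ω : ℝ} {f : ℂ → ℂ} (hf : f ∈ univalentGerms (multiplier ω))
    (m : ℕ) (hm : 2 ≤ m) : ‖PowerSeries.coeff m (taylorSeries f)‖ ≤ coeffConst ^ (m - 1) := by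
  obtain ⟨ha, hinj, h0, h1⟩ := hf
  set M : ℝ := 2 * (1 + Real.exp 384)
  have hM : 1 ≤ M := by have := Real.exp_pos 384; simp only [M]; linarith
  have hd : DiffContOnCl ℂ f (ball 0 (1 / 2)) := by
    refine DifferentiableOn.diffContOnCl (ha.differentiableOn.mono ?_)
    rw [closure_ball _ (by norm_num)]
    exact closedBall_subset_ball (by norm_num)
  have hb := Complex.norm_iteratedDeriv_le_of_forall_mem_sphere_norm_le m (C := M)
    (by norm_num : (0 : ℝ) < 1 / 2) hd fun z hz =>
      norm_le_of_univalent ha hinj h0 (by rw [h1, norm_multiplier]) (by simpa using hz.le)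
  have hfac : (0 : ℝ) < m.factorial := by exact_mod_cast m.factorial_pos
  rw [taylorSeries, PowerSeries.coeff_mk, norm_div, Complex.norm_natCast,
    div_le_iff₀ hfac]
  refine hb.trans ?_
  obtain ⟨k, rfl⟩ : ∃ k, m = k + 1 := ⟨m - 1, by omega⟩
  have hk : 1 ≤ k := by omega
  have e : ((k + 1).factorial : ℝ) * M / (1 / 2) ^ (k + 1) =
      M * 2 ^ (k + 1) * (k + 1).factorial := by
    rw [one_div, inv_pow, div_inv_eq_mul]; ring
  rw [e, add_tsub_cancel_right, coeffConst, mul_pow]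
  refine mul_le_mul_of_nonneg_right ?_ hfac.le
  have h2 : (2 : ℝ) ^ (k + 1) ≤ 4 ^ k := by
    rw [show (4 : ℝ) = 2 ^ 2 by norm_num, ← pow_mul]
    exact pow_le_pow_right₀ (by norm_num) (by omega)
  have h3 : M ≤ M ^ k := le_self_pow₀ hM (by omega)
  calc M * 2 ^ (k + 1) ≤ M ^ k * 4 ^ k := by gcongr
    _ = _ := mul_comm _ _

/-! ### The lower bound for the radius of convergence -/

/-- The universal constant of the lower bound. -/
def radiusConst : ℝ := Real.log (16 * coeffConst) + costConst

lemma one_le_coeffConst : 1 ≤ coeffConst := by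
  have := Real.exp_pos 384
  rw [coeffConst]; linarith

lemma costConst_nonneg : 0 ≤ costConst := by
  have h1 : 0 ≤ (1 - geomBase)⁻¹ := inv_nonneg.2 (by linarith [geomBase_lt_one])
  have h2 : 0 ≤ Real.log 2 := Real.log_nonneg (by norm_num)
  rw [costConst]; linarith

theorem ofReal_exp_le_convRadius {ω : ℝ} (hω : Irrational ω) (hB : brjunoFunction ω ≠ ⊤)
    {f : ℂ → ℂ} (hf : f ∈ univalentGerms (multiplier ω)) :
    ENNReal.ofReal (Real.exp (-((brjunoFunction ω).toReal + radiusConst))) ≤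
      convRadius (linearization (taylorSeries f)) := by
  obtain ⟨D, hD0, hD, hDl, hDB⟩ := DivisorTree.exists_superadditive (divisorCost ω) _
    (weight_divisorCost_le hω hB)
  set S : ℝ := (brjunoFunction ω).toReal + costConst
  have hS : 0 ≤ S := add_nonneg ENNReal.toReal_nonneg costConst_nonneg
  have c0 : PowerSeries.coeff 0 (taylorSeries f) = 0 := by simp [taylorSeries, hf.2.2.1]
  have c1 : PowerSeries.coeff 1 (taylorSeries f) = multiplier ω := by
    simp [taylorSeries, hf.2.2.2]
  have hH := (isLinearization_linearization hω hf).1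
  set H := linearization (taylorSeries f)
  have hcc := one_le_coeffConst
  have hbound := norm_coeff_linearization_le hH c0 (by rw [c1, norm_multiplier])
    (by rw [c1]; exact multiplier_pow_ne hω) (zero_lt_one.trans_le hcc)
    (norm_coeff_taylorSeries_le hf) hD0 hD hDl (fun n => le_max_left _ _)
    (by rw [c1]; exact fun n => le_max_right _ _)
  refine FormalMultilinearSeries.le_radius_of_bound _ 1 (r := Real.toNNReal _) fun n => ?_
  rw [FormalMultilinearSeries.ofScalars_norm, Real.coe_toNNReal _ (Real.exp_pos _).le]
  rcases Nat.eq_zero_or_pos n with rfl | hn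
  · rw [hH.coeff_zero]; simp
  have e : Real.exp (-((brjunoFunction ω).toReal + radiusConst)) =
      (16 * coeffConst)⁻¹ * Real.exp (-S) := by
    rw [radiusConst, show -((brjunoFunction ω).toReal + (Real.log (16 * coeffConst) + costConst)) =
      -Real.log (16 * coeffConst) + -S by simp only [S]; ring, Real.exp_add, Real.exp_neg,
      Real.exp_log (by linarith)]
  have h1 : ‖PowerSeries.coeff n H‖ ≤ (16 * coeffConst) ^ n * Real.exp S ^ n := by
    refine (hbound n hn).trans ((div_le_self (by positivity) ?_).trans ?_)
    · exact one_le_pow₀ (by exact_mod_cast hn)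
    · refine mul_le_mul (pow_le_pow_right₀ (by linarith) (Nat.sub_le n 1)) ?_
        (Real.exp_pos _).le (by positivity)
      rw [← Real.exp_nat_mul, Real.exp_le_exp, mul_comm]
      refine (hDB _).trans (mul_le_mul_of_nonneg_left ?_ hS)
      exact_mod_cast Nat.sub_le n 1
  rw [e]
  refine (mul_le_mul_of_nonneg_right h1 (by positivity)).trans (le_of_eq ?_)
  rw [← mul_pow, ← mul_pow, Real.exp_neg]
  have : 16 * coeffConst ≠ 0 := by linarith
  have := Real.exp_ne_zero S
  field_simp
  exact one_pow n

end SiegelCenter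

end

theorem theorem2p1 :
    ∃ C : ℝ, ∀ ω : ℝ, Irrational ω →
      -((SiegelCenter.brjunoFunction ω : ℝ≥0∞) : EReal) - (C : EReal) ≤
        ENNReal.log (SiegelCenter.infRadius ω) := by
  refine ⟨SiegelCenter.radiusConst, fun ω hω => ?_⟩
  by_cases hB : SiegelCenter.brjunoFunction ω = ⊤
  · simp [hB]
  have h : ENNReal.ofReal
      (Real.exp (-((SiegelCenter.brjunoFunction ω).toReal + SiegelCenter.radiusConst))) ≤
      SiegelCenter.infRadius ω :=
    le_iInf₂ fun f hf => SiegelCenter.ofReal_exp_le_convRadius hω hB hf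
  refine le_trans (le_of_eq ?_) (ENNReal.log_monotone h)
  rw [ENNReal.log_ofReal_of_pos (Real.exp_pos _), Real.log_exp, neg_add, EReal.coe_add,
    EReal.coe_neg, EReal.coe_neg, ← sub_eq_add_neg, EReal.coe_ennreal_toReal hB]
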